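/- All manifolds are finite-dimensional, smooth, Hausdorff, second countable and without boundary. Let $G\rightrightarrows M$ be a Lie groupoid, with source and target submersions $s,t:G\to M$, and let $x\in M$. Write $G_x=s^{-1}(x)\cap t^{-1}(x)$ for the isotropy group at $x$ and $O_x=t(s^{-1}(x))\subset M$ for the orbit of $x$, which carries the topology of its canonical manifold structure, i.e. the quotient topology for $t:s^{-1}(x)\to O_x$. A map $f:X\to Y$ is *proper at* $y\in Y$ if every sequence $(a_n)$ in $X$ with $f(a_n)\to y$ has a convergent subsequence; it is *locally trivial at* $y$ if there are an open $V\ni y$ and a diffeomorphism $f^{-1}(V)\cong f^{-1}(y)\times V$ over $V$. The groupoid $G$ is *s-proper at* $x$ (*s-locally trivial at* $x$) if $s$ is proper (locally trivial) at $x$, and *proper at* $x$ if the map $(t,s):G\to M\times M$ is proper at $(x,x)$. A subset of $M$ is *saturated* if it is a union of orbits, and $O_x$ is *stable* if for every open $U\subset M$ containing $O_x$ there is a saturated open $V$ with $O_x\subset V\subset U$. The following are equivalent: 1. $G$ is s-proper at $x$; 2. $G$ is proper at $x$, the orbit $O_x$ is stable, and, in case $O_x$ is open in $M$, $O_x$ is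 compact; 3. $G$ is s-locally trivial at $x$, and both $G_x$ and $O_x$ are compact. -/

import Mathlib

open Set Filter Topology
open scoped Manifold ContDiff

/-- A map `f : X → Y` is *proper at* `y` if every sequence `a` in `X` with `f (a n) → y` has a
convergent subsequence. -/
def ProperAt {X Y : Type*} [TopologicalSpace X] [TopologicalSpace Y] (f : X → Y) (y : Y) : Prop :=
  ∀ a : ℕ → X, Tendsto (fun n => f (a n)) atTop (𝓝 y) →
    ∃ (p : X) (φ : ℕ → ℕ), StrictMono φ ∧ Tendsto (fun n => a (φ n)) atTop (𝓝 p)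

/-- A map `f : X → Y` of manifolds is *locally trivial at* `y`, with fibre `F = f⁻¹(y)`, if there
are an open neighbourhood `V` of `y` and a diffeomorphism `Ψ : f⁻¹(V) → F × V`, with inverse `Φ`,
whose second component is `f`. Here `f⁻¹(V)` and `F × V` are regarded as subsets of the manifolds
`X` and `X × Y`, and smoothness is smoothness on subsets; this is smoothness with respect to the
submanifold structures when `f` is a submersion, so that `F` is an embedded submanifold of `X`. -/
def LocallyTrivialAt (EX EY : Type*) {X Y : Type*}
    [NormedAddCommGroup EX] [NormedSpace ℝ EX] [NormedAddCommGroup EY] [NormedSpace ℝ EY]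
    [TopologicalSpace X] [ChartedSpace EX X] [TopologicalSpace Y] [ChartedSpace EY Y]
    (f : X → Y) (y : Y) : Prop :=
  ∃ V : Set Y, IsOpen V ∧ y ∈ V ∧
    ∃ (Ψ : X → X × Y) (Φ : X × Y → X),
      ContMDiffOn 𝓘(ℝ, EX) (𝓘(ℝ, EX).prod 𝓘(ℝ, EY)) ∞ Ψ (f ⁻¹' V) ∧
      ContMDiffOn (𝓘(ℝ, EX).prod 𝓘(ℝ, EY)) 𝓘(ℝ, EX) ∞ Φ ((f ⁻¹' {y}) ×ˢ V) ∧
      MapsTo Ψ (f ⁻¹' V) ((f ⁻¹' {y}) ×ˢ V) ∧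
      MapsTo Φ ((f ⁻¹' {y}) ×ˢ V) (f ⁻¹' V) ∧
      InvOn Φ Ψ (f ⁻¹' V) ((f ⁻¹' {y}) ×ˢ V) ∧
      ∀ g ∈ f ⁻¹' V, (Ψ g).2 = f g

/-- A *Lie groupoid* with manifold of arrows `G` (modelled on `EG`) and manifold of objects `M`
(modelled on `EM`). The source and the target are submersions. The multiplication `mul g₂ g₁` is
only meaningful (and only constrained) on the submanifold `{(g₂, g₁) | src g₂ = tgt g₁}` of `G × G`
of composable pairs, on which it is smooth. -/
structure LieGroupoid (EG EM G M : Type*)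
    [NormedAddCommGroup EG] [NormedSpace ℝ EG] [NormedAddCommGroup EM] [NormedSpace ℝ EM]
    [TopologicalSpace G] [ChartedSpace EG G] [TopologicalSpace M] [ChartedSpace EM M] where
  /-- source -/
  src : G → M
  /-- target -/
  tgt : G → M
  /-- multiplication of composable arrows -/
  mul : G → G → G
  /-- unit arrows -/
  unit : M → G
  /-- inverse arrows -/
  inv : G → G
  src_submersion : Manifold.IsSubmersion 𝓘(ℝ, EG) 𝓘(ℝ, EM) ∞ src
  tgt_submersion : Manifold.IsSubmersion 𝓘(ℝ, EG) 𝓘(ℝ, EM) ∞ tgt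
  mul_smooth : ContMDiffOn (𝓘(ℝ, EG).prod 𝓘(ℝ, EG)) 𝓘(ℝ, EG) ∞
    (fun p : G × G => mul p.1 p.2) {p : G × G | src p.1 = tgt p.2}
  unit_smooth : ContMDiff 𝓘(ℝ, EM) 𝓘(ℝ, EG) ∞ unit
  inv_smooth : ContMDiff 𝓘(ℝ, EG) 𝓘(ℝ, EG) ∞ inv
  src_mul : ∀ g₂ g₁ : G, src g₂ = tgt g₁ → src (mul g₂ g₁) = src g₁
  tgt_mul : ∀ g₂ g₁ : G, src g₂ = tgt g₁ → tgt (mul g₂ g₁) = tgt g₂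
  src_unit : ∀ x : M, src (unit x) = x
  tgt_unit : ∀ x : M, tgt (unit x) = x
  src_inv : ∀ g : G, src (inv g) = tgt g
  tgt_inv : ∀ g : G, tgt (inv g) = src g
  mul_assoc : ∀ g₃ g₂ g₁ : G, src g₃ = tgt g₂ → src g₂ = tgt g₁ →
    mul (mul g₃ g₂) g₁ = mul g₃ (mul g₂ g₁)
  mul_unit : ∀ g : G, mul g (unit (src g)) = g
  unit_mul : ∀ g : G, mul (unit (tgt g)) g = g
  mul_inv : ∀ g : G, mul g (inv g) = unit (tgt g)
  inv_mul : ∀ g : G, mul (inv g) g = unit (src g)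

namespace LieGroupoid

variable {EG EM G M : Type*}
  [NormedAddCommGroup EG] [NormedSpace ℝ EG] [NormedAddCommGroup EM] [NormedSpace ℝ EM]
  [TopologicalSpace G] [ChartedSpace EG G] [TopologicalSpace M] [ChartedSpace EM M]

/-- The `s`-fibre `G(-, x)`: the arrows with source `x`. -/
def sFiber (𝒢 : LieGroupoid EG EM G M) (x : M) : Set G := {g | 𝒢.src g = x}

/-- The isotropy group `G_x`: the arrows from `x` to `x`. -/
def isotropy (𝒢 : LieGroupoid EG EM G M) (x : M) : Set G := {g | 𝒢.src g = x ∧ 𝒢.tgt g = x}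

/-- The orbit `O_x`: the targets of the arrows with source `x`. -/
def orbit (𝒢 : LieGroupoid EG EM G M) (x : M) : Set M := 𝒢.tgt '' 𝒢.sFiber x

/-- The target map `G(-, x) → O_x`. -/
def toOrbit (𝒢 : LieGroupoid EG EM G M) (x : M) (g : 𝒢.sFiber x) : 𝒢.orbit x :=
  ⟨𝒢.tgt g, g, g.2, rfl⟩

/-- The topology of the canonical manifold structure of the orbit: the quotient topology for
`G(-, x) → O_x`, that is, for the identification of `O_x` with `G(-, x) / G_x`. It may be finer
than the subspace topology, since `O_x` need not be an embedded submanifold. -/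
abbrev orbitTopology (𝒢 : LieGroupoid EG EM G M) (x : M) : TopologicalSpace (𝒢.orbit x) :=
  TopologicalSpace.coinduced (𝒢.toOrbit x) inferInstance

/-- The orbit `O_x`, with its canonical topology, is compact. -/
def OrbitCompact (𝒢 : LieGroupoid EG EM G M) (x : M) : Prop :=
  @CompactSpace (𝒢.orbit x) (𝒢.orbitTopology x)

/-- A set of objects is *saturated* if it contains the orbit of each of its points. -/
def Saturated (𝒢 : LieGroupoid EG EM G M) (V : Set M) : Prop :=
  ∀ y ∈ V, 𝒢.orbit y ⊆ V

/-- The orbit `O_x` is *stable* if it has arbitrarily small saturated open neighbourhoods. -/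
def OrbitStable (𝒢 : LieGroupoid EG EM G M) (x : M) : Prop :=
  ∀ U : Set M, IsOpen U → 𝒢.orbit x ⊆ U →
    ∃ V : Set M, IsOpen V ∧ 𝒢.Saturated V ∧ 𝒢.orbit x ⊆ V ∧ V ⊆ U

/-- The anchor map `(t, s) : G → M × M`. -/
def anchor (𝒢 : LieGroupoid EG EM G M) (g : G) : M × M := (𝒢.tgt g, 𝒢.src g)

/-- `G` is *proper at* `x` if the anchor is proper at `(x, x)`. -/
def IsProperAt (𝒢 : LieGroupoid EG EM G M) (x : M) : Prop := ProperAt 𝒢.anchor (x, x)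

/-- `G` is *s-proper at* `x` if the source map is proper at `x`. -/
def IsSProperAt (𝒢 : LieGroupoid EG EM G M) (x : M) : Prop := ProperAt 𝒢.src x

/-- `G` is *s-locally trivial at* `x` if the source map is locally trivial at `x`. -/
def IsSLocallyTrivialAt (𝒢 : LieGroupoid EG EM G M) (x : M) : Prop :=
  LocallyTrivialAt EG EM 𝒢.src x

end LieGroupoid

/-! From s-properness to s-local triviality is Ehresmann's theorem at a single point `y`. Properness
at `y` makes the fibre compact and yields a tube lemma, `ProperAt.eventually_of_nhdsSet`. A compact
fibre has a smooth retraction `ρ` from a neighbourhood, glued from chart projections by cut-off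
functions. The map `(ρ, f)` is a local diffeomorphism along the fibre by the inverse function
theorem. It is injective near the fibre by a sequence argument, and it is onto a product by
compactness.

Conversely, `s⁻¹(x) → O_x` is an open map whose fibres are translates of `G_x`. So `s⁻¹(x)` is
compact when `G_x` and `O_x` are, and a locally trivial map with compact fibre is proper there.

If `s` is proper at `x`, the tube lemma makes all arrows that start near `x` end near `O_x`, which
gives stability. Conversely, let `s(aₙ) → x`. Once a subsequence of the targets converges to a point
of `O_x`, composing with arrows back to `x` reduces to properness at `(x, x)`. If `O_x` is open,
such a subsequence exists by compactness. If not, each `aₙ` can be moved slightly so that its target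
leaves `O_x`. If these targets had no cluster point in `O_x`, a neighbourhood of `O_x` would avoid
them all, against stability. -/

/-! ### Submersions in charts and the inverse function theorem. -/

/-- A pair of smooth charts in which `f` is the projection `EY × F → EY`. -/
structure SubmersionChart (EX EY F : Type*) {X Y : Type*}
    [NormedAddCommGroup EX] [NormedSpace ℝ EX] [NormedAddCommGroup EY] [NormedSpace ℝ EY]
    [NormedAddCommGroup F] [NormedSpace ℝ F]
    [TopologicalSpace X] [ChartedSpace EX X] [TopologicalSpace Y] [ChartedSpace EY Y]
    (f : X → Y) where
  /-- the chart of the domain -/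
  dom : OpenPartialHomeomorph X (EY × F)
  /-- the chart of the codomain -/
  cod : OpenPartialHomeomorph Y EY
  contMDiffAt_dom : ∀ q ∈ dom.source, ContMDiffAt 𝓘(ℝ, EX) 𝓘(ℝ, EY × F) ∞ dom q
  contMDiffAt_dom_symm : ∀ w ∈ dom.target, ContMDiffAt 𝓘(ℝ, EY × F) 𝓘(ℝ, EX) ∞ dom.symm w
  contMDiffAt_cod : ∀ v ∈ cod.source, ContMDiffAt 𝓘(ℝ, EY) 𝓘(ℝ, EY) ∞ cod v
  mapsTo : MapsTo f dom.source cod.source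
  cod_apply : ∀ q ∈ dom.source, cod (f q) = (dom q).1

universe u in
theorem Manifold.IsSubmersion.exists_submersionChart {EX : Type u} {EY X Y : Type*}
    [NormedAddCommGroup EX] [NormedSpace ℝ EX] [FiniteDimensional ℝ EX]
    [NormedAddCommGroup EY] [NormedSpace ℝ EY]
    [TopologicalSpace X] [ChartedSpace EX X] [TopologicalSpace Y] [ChartedSpace EY Y]
    {f : X → Y} (hf : Manifold.IsSubmersion 𝓘(ℝ, EX) 𝓘(ℝ, EY) ∞ f) (p : X) :
    ∃ (F : Type u) (_ : NormedAddCommGroup F) (_ : NormedSpace ℝ F) (_ : FiniteDimensional ℝ F)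
      (c : SubmersionChart EX EY F f), p ∈ c.dom.source := by
  obtain ⟨F, _, _, h⟩ := hf.isSubmersionAt p
  have hfin : FiniteDimensional ℝ F :=
    Module.Finite.of_surjective
      ((LinearMap.snd ℝ EY F).comp h.equiv.toLinearEquiv.toLinearMap)
      (Prod.snd_surjective.comp h.equiv.surjective)
  refine ⟨F, inferInstance, inferInstance, hfin,
    ⟨h.domChart.transHomeomorph h.equiv.toHomeomorph, h.codChart, ?_, ?_, ?_, ?_, ?_⟩, ?_⟩
  · intro q hq
    exact (h.equiv.contDiff.contMDiff.contMDiffAt).comp q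
      (contMDiffAt_of_mem_maximalAtlas h.domChart_mem_maximalAtlas hq)
  · intro w hw
    refine ContMDiffAt.comp (x := w) (g := h.domChart.symm) (f := h.equiv.symm)
      (contMDiffAt_symm_of_mem_maximalAtlas h.domChart_mem_maximalAtlas hw)
      h.equiv.symm.contDiff.contMDiff.contMDiffAt
  · exact fun v hv => contMDiffAt_of_mem_maximalAtlas h.codChart_mem_maximalAtlas hv
  · exact h.mapsto_domChart_source_codChart_source
  · intro q hq
    have hq' : q ∈ h.domChart.source := hq
    have hm : h.domChart q ∈ (h.domChart.extend 𝓘(ℝ, EX)).target := by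
      simpa using h.domChart.map_source hq'
    have := h.writtenInCharts hm
    simpa [h.domChart.left_inv hq'] using this
  · exact h.mem_domChart_source

section Submersion

variable {EX EY F X Y : Type*}
    [NormedAddCommGroup EX] [NormedSpace ℝ EX] [NormedAddCommGroup EY] [NormedSpace ℝ EY]
    [NormedAddCommGroup F] [NormedSpace ℝ F]
    [TopologicalSpace X] [ChartedSpace EX X] [TopologicalSpace Y] [ChartedSpace EY Y]
    {f : X → Y}

namespace SubmersionChart

theorem cod_fst (c : SubmersionChart EX EY F f) {w : EY × F} (hw : w ∈ c.dom.target) :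
    c.cod (f (c.dom.symm w)) = w.1 := by
  rw [c.cod_apply _ (c.dom.map_target hw), c.dom.right_inv hw]

theorem map_symm_eq (c : SubmersionChart EX EY F f) {w : EY × F} (hw : w ∈ c.dom.target)
    {v : Y} (hv : v ∈ c.cod.source) (h : w.1 = c.cod v) : f (c.dom.symm w) = v :=
  c.cod.injOn (c.mapsTo (c.dom.map_target hw)) hv (by rw [c.cod_fst hw, h])

/-- A submersion has continuous local sections. -/
theorem exists_local_section (c : SubmersionChart EX EY F f) {p : X} (hp : p ∈ c.dom.source) :
    ∃ σ : Y → X, σ (f p) = p ∧ ContinuousAt σ (f p) ∧ ∀ᶠ v in 𝓝 (f p), f (σ v) = v := by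
  have hfp := c.mapsTo hp
  have hw : ((c.cod (f p), (c.dom p).2) : EY × F) = c.dom p :=
    Prod.ext (c.cod_apply p hp) rfl
  have hcont : ContinuousAt (fun v => ((c.cod v, (c.dom p).2) : EY × F)) (f p) :=
    (c.cod.continuousAt hfp).prodMk continuousAt_const
  refine ⟨fun v => c.dom.symm (c.cod v, (c.dom p).2), ?_, ?_, ?_⟩
  · simp only [hw, c.dom.left_inv hp]
  · refine ContinuousAt.comp (g := c.dom.symm) ?_ hcont
    rw [hw]
    exact c.dom.continuousAt_symm (c.dom.map_source hp)
  · have h1 : ∀ᶠ v in 𝓝 (f p), ((c.cod v, (c.dom p).2) : EY × F) ∈ c.dom.target :=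
      hcont.eventually_mem (by rw [hw]; exact c.dom.open_target.mem_nhds (c.dom.map_source hp))
    filter_upwards [h1, c.cod.open_source.mem_nhds hfp] with v h2 h3
    exact c.map_symm_eq h2 h3 rfl

end SubmersionChart

theorem Manifold.IsSubmersion.exists_local_section [FiniteDimensional ℝ EX]
    (hf : Manifold.IsSubmersion 𝓘(ℝ, EX) 𝓘(ℝ, EY) ∞ f) (p : X) :
    ∃ σ : Y → X, σ (f p) = p ∧ ContinuousAt σ (f p) ∧ ∀ᶠ v in 𝓝 (f p), f (σ v) = v := by
  obtain ⟨F, _, _, _, c, hp⟩ := hf.exists_submersionChart p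
  exact c.exists_local_section hp

/-- A continuous local section through `p` carries `𝓝 (f p)` into `𝓝 p`, and `f` carries it back
onto itself. -/
theorem Manifold.IsSubmersion.isOpenMap [FiniteDimensional ℝ EX]
    (hf : Manifold.IsSubmersion 𝓘(ℝ, EX) 𝓘(ℝ, EY) ∞ f) : IsOpenMap f := by
  refine IsOpenMap.of_nhds_le fun p => ?_
  obtain ⟨σ, h0, hσ, h⟩ := hf.exists_local_section p
  have h1 : map f (map σ (𝓝 (f p))) = 𝓝 (f p) := by
    rw [Filter.map_map]
    exact (Filter.map_congr h).trans Filter.map_id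
  rw [← h1]
  exact Filter.map_mono (by simpa [ContinuousAt, Tendsto, h0] using hσ)

end Submersion

/-- The inverse function theorem, with smoothness of the inverse near the point. -/
theorem ContDiffAt.exists_openPartialHomeomorph {E : Type*} [NormedAddCommGroup E] [NormedSpace ℝ E]
    [CompleteSpace E] {R : E → E} {a : E} (hR : ∀ᶠ w in 𝓝 a, ContDiffAt ℝ ∞ R w)
    (A : E ≃L[ℝ] E) (hA : HasFDerivAt R (A : E →L[ℝ] E) a) :
    ∃ e : OpenPartialHomeomorph E E, a ∈ e.source ∧ (∀ w, e w = R w) ∧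
      ∀ᶠ z in 𝓝 (R a), ContDiffAt ℝ ∞ e.symm z := by
  have hRa := hR.self_of_nhds
  let e := hRa.toOpenPartialHomeomorph R hA (by simp)
  have hea : a ∈ e.source := hRa.mem_toOpenPartialHomeomorph_source hA (by simp)
  have heR : ∀ w, e w = R w := fun w => rfl
  refine ⟨e, hea, heR, ?_⟩
  -- Smoothness of the inverse at nearby points needs an invertible derivative there too;
  -- invertibility is an open condition.
  have hfd : ∀ᶠ w in 𝓝 a, fderiv ℝ R w ∈ range ((↑) : (E ≃L[ℝ] E) → (E →L[ℝ] E)) := by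
    have hc : ContinuousAt (fderiv ℝ R) a :=
      (hRa.fderiv_right (m := 0) (by simp)).continuousAt
    refine hc.eventually_mem ?_
    rw [hA.fderiv]
    exact A.nhds
  have hta : R a ∈ e.target := e.map_source hea
  have hsymm : Tendsto e.symm (𝓝 (R a)) (𝓝 a) := by
    have := e.continuousAt_symm hta
    rwa [ContinuousAt, ← heR a, e.left_inv hea] at this
  filter_upwards [e.open_target.mem_nhds hta, hsymm.eventually hR, hsymm.eventually hfd]
    with z hz h1 ⟨B, hB⟩
  refine e.contDiffAt_symm (f₀' := B) hz ?_ h1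
  rw [hB]
  exact (h1.differentiableAt (by simp)).hasFDerivAt

/-! ### Smooth retractions onto a compact fibre. -/

section Retraction

variable {EX EY F X Y : Type*}
    [NormedAddCommGroup EX] [NormedSpace ℝ EX] [NormedAddCommGroup EY] [NormedSpace ℝ EY]
    [NormedAddCommGroup F] [NormedSpace ℝ F]
    [TopologicalSpace X] [ChartedSpace EX X] [TopologicalSpace Y] [ChartedSpace EY Y]
    {f : X → Y} {y : Y} {ρ ρ' : X → X} {p : X}

/-- `ρ` is smooth at `q`, maps `q` into the fibre `f⁻¹(y)`, and fixes `q` if `q` lies in it. -/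
def RetractsAt (EX : Type*) {X Y : Type*} [NormedAddCommGroup EX] [NormedSpace ℝ EX]
    [TopologicalSpace X] [ChartedSpace EX X] (f : X → Y) (y : Y) (ρ : X → X) (q : X) : Prop :=
  ContMDiffAt 𝓘(ℝ, EX) 𝓘(ℝ, EX) ∞ ρ q ∧ f (ρ q) = y ∧ (f q = y → ρ q = q)

omit [TopologicalSpace Y] in
theorem RetractsAt.eventually_congr (h : ∀ᶠ q in 𝓝 p, RetractsAt EX f y ρ' q) (hρ : ρ =ᶠ[𝓝 p] ρ') :
    ∀ᶠ q in 𝓝 p, RetractsAt EX f y ρ q := by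
  filter_upwards [h, hρ.eventuallyEq_nhds] with q ⟨h1, h2, h3⟩ h4
  exact ⟨h1.congr_of_eventuallyEq h4, by rw [h4.eq_of_nhds, h2], fun h => by
    rw [h4.eq_of_nhds, h3 h]⟩

/-- In the chart the fibre is a slice, so a retraction is any smooth `w` into that slice which is
the chart itself on the fibre. It serves both for the interpolated map and for the plain chart
projection. -/
theorem SubmersionChart.eventually_retractsAt (c : SubmersionChart EX EY F f)
    (hp : p ∈ c.dom.source) (hfp : f p = y) {w : X → EY × F}
    (hw : ∀ᶠ q in 𝓝 p, ContMDiffAt 𝓘(ℝ, EX) 𝓘(ℝ, EY × F) ∞ w q ∧ (w q).1 = c.cod y ∧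
      (f q = y → w q = c.dom q)) :
    ∀ᶠ q in 𝓝 p, RetractsAt EX f y (fun q => c.dom.symm (w q)) q := by
  have hwp := hw.self_of_nhds
  have hyc : y ∈ c.cod.source := hfp ▸ c.mapsTo hp
  have ht : ∀ᶠ q in 𝓝 p, w q ∈ c.dom.target := hwp.1.continuousAt.eventually_mem <| by
    rw [hwp.2.2 hfp]
    exact c.dom.open_target.mem_nhds (c.dom.map_source hp)
  filter_upwards [hw, ht, c.dom.open_source.mem_nhds hp] with q ⟨h1, h2, h3⟩ h4 h5
  refine ⟨(c.contMDiffAt_dom_symm _ h4).comp q h1, c.map_symm_eq h4 hyc h2, fun h => ?_⟩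
  simp only [h3 h, c.dom.left_inv h5]

/-- Near a point of a fibre, a smooth retraction onto the fibre that is defined near part of it can
be extended by interpolation in a chart. -/
theorem SubmersionChart.exists_retraction_union [FiniteDimensional ℝ EX] [T2Space X]
    [SecondCountableTopology X] [IsManifold 𝓘(ℝ, EX) ∞ X]
    (c : SubmersionChart EX EY F f) (hp : p ∈ c.dom.source) :
    ∃ N : Set X, IsOpen N ∧ p ∈ N ∧ ∀ K ⊆ f ⁻¹' {y},
      (∃ ρ, ∀ᶠ q in 𝓝ˢ K, RetractsAt EX f y ρ q) →
      ∃ ρ, ∀ᶠ q in 𝓝ˢ (K ∪ N ∩ f ⁻¹' {y}), RetractsAt EX f y ρ q := by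
  have : LocallyCompactSpace X := ChartedSpace.locallyCompactSpace EX X
  obtain ⟨χ, h0, h1, -⟩ := exists_contMDiffMap_zero_one_nhds_of_isClosed (n := ⊤) 𝓘(ℝ, EX)
    c.dom.open_source.isClosed_compl (isClosed_singleton (x := p)) (by simpa using hp)
  rw [nhdsSet_singleton] at h1
  have hts : tsupport χ ⊆ c.dom.source := by
    intro q hq
    by_contra hqs
    exact notMem_tsupport_iff_eventuallyEq.2 (eventually_nhdsSet_iff_forall.1 h0 q hqs) hq
  -- This neighbourhood depends on neither `K` nor `ρ`, so a finite subcover can be fixed before the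
  -- retraction is built by induction.
  refine ⟨{q | ∀ᶠ q' in 𝓝 q, χ q' = 1}, isOpen_setOfPred_eventually_nhds, h1, ?_⟩
  rintro K hK ⟨ρ, hρ⟩
  classical
  -- Both interpolated points have first coordinate `c.cod y`, an affine condition, so the result
  -- stays in the fibre. Where `χ` vanishes, this is `ρ` read in the chart.
  let w : X → EY × F := fun q =>
    (1 - χ q) • c.dom (ρ q) + χ q • ((c.cod y, (c.dom q).2) : EY × F)
  refine ⟨fun q => if q ∈ tsupport χ then c.dom.symm (w q) else ρ q, ?_⟩
  rw [eventually_nhdsSet_iff_forall] at hρ ⊢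
  have hdom : ∀ {q}, f q = y → q ∈ c.dom.source → (c.cod y, (c.dom q).2) = c.dom q :=
    fun h1 h2 => Prod.ext (by rw [← c.cod_apply _ h2, h1]) rfl
  have hsm : ∀ q ∈ c.dom.source, ContMDiffAt 𝓘(ℝ, EX) 𝓘(ℝ, EY × F) ∞
      (fun q => ((c.cod y, (c.dom q).2) : EY × F)) q := by
    intro q hq
    have : ContDiff ℝ ∞ (fun z : EY × F => ((c.cod y, z.2) : EY × F)) :=
      contDiff_const.prodMk contDiff_snd
    exact this.contMDiff.contMDiffAt.comp q (c.contMDiffAt_dom q hq)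
  rintro a (ha | ⟨ha, hfa⟩)
  · have hfa : f a = y := hK ha
    have hρa := hρ a ha
    have hρaa : ρ a = a := hρa.self_of_nhds.2.2 hfa
    by_cases hat : a ∈ tsupport χ
    · have hac := hts hat
      have hcont : ContinuousAt ρ a := hρa.self_of_nhds.1.continuousAt
      have hρs : ∀ᶠ q in 𝓝 a, ρ q ∈ c.dom.source :=
        hcont.eventually_mem (by rw [hρaa]; exact c.dom.open_source.mem_nhds hac)
      refine RetractsAt.eventually_congr (c.eventually_retractsAt hac hfa (w := w) ?_) ?_
      · filter_upwards [hρa, hρs, c.dom.open_source.mem_nhds hac] with q ⟨hq1, hq2, hq3⟩ hq4 hq5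
        refine ⟨?_, ?_, fun h => ?_⟩
        · exact ((contMDiffAt_const.sub χ.contMDiff.contMDiffAt).smul
            ((c.contMDiffAt_dom _ hq4).comp q hq1)).add
            (χ.contMDiff.contMDiffAt.smul (hsm q hq5))
        · have : (c.dom (ρ q)).1 = c.cod y := by rw [← c.cod_apply _ hq4, hq2]
          simp [w, this, sub_smul]
        · simp only [w, hq3 h, hdom h hq5, ← add_smul, sub_add_cancel, one_smul]
      · filter_upwards [hρs] with q hq
        split_ifs with h
        · rfl
        · simp only [w, image_eq_zero_of_notMem_tsupport h, sub_zero, one_smul, zero_smul, add_zero,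
            c.dom.left_inv hq]
    · refine RetractsAt.eventually_congr hρa ?_
      filter_upwards [(isClosed_tsupport χ).isOpen_compl.mem_nhds hat] with q hq
      exact if_neg hq
  · have hχ : ∀ᶠ q in 𝓝 a, q ∈ tsupport χ := by
      filter_upwards [ha] with q hq
      exact subset_tsupport _ (by simp [hq])
    have hac : a ∈ c.dom.source := hts hχ.self_of_nhds
    refine RetractsAt.eventually_congr (c.eventually_retractsAt hac hfa
      (w := fun q => (c.cod y, (c.dom q).2)) ?_) ?_
    · filter_upwards [c.dom.open_source.mem_nhds hac] with q hq
      exact ⟨hsm q hq, rfl, fun h => hdom h hq⟩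
    · filter_upwards [hχ, ha] with q hq hq1
      rw [if_pos hq]
      simp [w, hq1]

/-- A compact fibre of a submersion is a smooth retract of a neighbourhood. -/
theorem Manifold.IsSubmersion.exists_retraction [FiniteDimensional ℝ EX] [T2Space X]
    [SecondCountableTopology X] [IsManifold 𝓘(ℝ, EX) ∞ X]
    (hf : Manifold.IsSubmersion 𝓘(ℝ, EX) 𝓘(ℝ, EY) ∞ f) (hc : IsCompact (f ⁻¹' {y})) :
    ∃ ρ : X → X, ∀ᶠ q in 𝓝ˢ (f ⁻¹' {y}), RetractsAt EX f y ρ q := by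
  have key : ∀ p : X, ∃ N : Set X, IsOpen N ∧ p ∈ N ∧ ∀ K ⊆ f ⁻¹' {y},
      (∃ ρ, ∀ᶠ q in 𝓝ˢ K, RetractsAt EX f y ρ q) →
      ∃ ρ, ∀ᶠ q in 𝓝ˢ (K ∪ N ∩ f ⁻¹' {y}), RetractsAt EX f y ρ q := by
    intro p
    obtain ⟨F, _, _, _, c, hp⟩ := hf.exists_submersionChart p
    exact c.exists_retraction_union hp
  choose N hNo hN h using key
  obtain ⟨t, -, ht⟩ := hc.elim_nhds_subcover N fun p _ => (hNo p).mem_nhds (hN p)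
  have : ∀ t : Finset X, ∃ ρ, ∀ᶠ q in 𝓝ˢ ((⋃ p ∈ t, N p) ∩ f ⁻¹' {y}), RetractsAt EX f y ρ q := by
    classical
    intro t
    induction t using Finset.induction_on with
    | empty => exact ⟨id, by simp⟩
    | insert a t _ ih =>
      have := h a _ inter_subset_right ih
      rwa [← union_inter_distrib_right, union_comm, ← Finset.set_biUnion_insert] at this
  obtain ⟨ρ, hρ⟩ := this t
  exact ⟨ρ, by rwa [inter_eq_right.2 ht] at hρ⟩

end Retraction

/-! ### Local inverses of `(ρ, f)`. -/

section Ehresmann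

variable {EX EY F X Y : Type*}
    [NormedAddCommGroup EX] [NormedSpace ℝ EX] [NormedAddCommGroup EY] [NormedSpace ℝ EY]
    [NormedAddCommGroup F] [NormedSpace ℝ F]
    [TopologicalSpace X] [ChartedSpace EX X] [TopologicalSpace Y] [ChartedSpace EY Y]
    {f : X → Y} {y : Y} {ρ : X → X} {p : X}

/-- If `R(u, v)` has first component `u`, and `R(u₀, v) = (u₀, v)`, then `R` has invertible
derivative at `(u₀, v₀)`. -/
theorem exists_continuousLinearEquiv_hasFDerivAt {E F : Type*}
    [NormedAddCommGroup E] [NormedSpace ℝ E] [FiniteDimensional ℝ E]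
    [NormedAddCommGroup F] [NormedSpace ℝ F] [FiniteDimensional ℝ F]
    {R : E × F → E × F} {a : E × F} (hR : DifferentiableAt ℝ R a)
    (h1 : ∀ᶠ w in 𝓝 a, (R w).1 = w.1) (h2 : ∀ᶠ v in 𝓝 a.2, (R (a.1, v)).2 = v) :
    ∃ A : (E × F) ≃L[ℝ] (E × F), HasFDerivAt R (A : E × F →L[ℝ] E × F) a := by
  set D := fderiv ℝ R a with hD
  have hRD : HasFDerivAt R D a := hR.hasFDerivAt
  -- The derivative is block triangular with identity diagonal blocks: the first row is `(id, 0)`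
  -- and the lower right block is `id`.
  have hfst : (ContinuousLinearMap.fst ℝ E F).comp D = ContinuousLinearMap.fst ℝ E F := by
    have e1 : HasFDerivAt (fun w => (R w).1) ((ContinuousLinearMap.fst ℝ E F).comp D) a := hRD.fst
    have e2 : HasFDerivAt (fun w => (R w).1) (ContinuousLinearMap.fst ℝ E F) a :=
      hasFDerivAt_fst.congr_of_eventuallyEq h1
    exact e1.unique e2
  have hsnd : ∀ v, (D (0, v)).2 = v := by
    have e0 : HasFDerivAt (fun v => ((a.1, v) : E × F)) (ContinuousLinearMap.inr ℝ E F) a.2 :=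
      hasFDerivAt_prodMk_right a.1 a.2
    have e1 : HasFDerivAt (fun v => (R (a.1, v)).2)
        (((ContinuousLinearMap.snd ℝ E F).comp D).comp (ContinuousLinearMap.inr ℝ E F)) a.2 :=
      HasFDerivAt.comp (g := fun w => (R w).2) (f := fun v => ((a.1, v) : E × F)) a.2 hRD.snd e0
    have e2 : HasFDerivAt (fun v => (R (a.1, v)).2) (ContinuousLinearMap.id ℝ F) a.2 :=
      (hasFDerivAt_id a.2).congr_of_eventuallyEq h2
    intro v
    simpa using congrArg (fun T : F →L[ℝ] F => T v) (e1.unique e2)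
  have hinj : Function.Injective D.toLinearMap := by
    rw [← LinearMap.ker_eq_bot, LinearMap.ker_eq_bot']
    rintro ⟨u, v⟩ h
    have hu : u = 0 := by
      have := congrArg (fun T : E × F →L[ℝ] E => T (u, v)) hfst
      simpa [show D (u, v) = 0 from h] using this.symm
    subst hu
    have hv : v = 0 := by rw [← hsnd v, show D (0, v) = 0 from h]; rfl
    rw [hv]; rfl
  refine ⟨(LinearEquiv.ofInjectiveEndo D.toLinearMap hinj).toContinuousLinearEquiv, ?_⟩
  convert hRD using 1
  ext w <;> rfl

/-- The map `q ↦ (ρ q, f q)` determined by a smooth retraction `ρ` onto the fibre `f⁻¹(y)` has a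
smooth local inverse near each point of the fibre. -/
theorem SubmersionChart.exists_local_inverse [FiniteDimensional ℝ EY] [FiniteDimensional ℝ F]
    (c : SubmersionChart EX EY F f) (hp : p ∈ c.dom.source) (hfp : f p = y)
    (hρ : ∀ᶠ q in 𝓝 p, RetractsAt EX f y ρ q) :
    ∃ Θ : X × Y → X, (∀ᶠ q in 𝓝 p, Θ (ρ q, f q) = q) ∧
      ∀ᶠ z in 𝓝 (p, y), ContMDiffAt (𝓘(ℝ, EX).prod 𝓘(ℝ, EY)) 𝓘(ℝ, EX) ∞ Θ z ∧
        (f z.1 = y → f (Θ z) = z.2 ∧ ρ (Θ z) = z.1) := by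
  have hy : y ∈ c.cod.source := hfp ▸ c.mapsTo hp
  have hρp : ρ p = p := hρ.self_of_nhds.2.2 hfp
  have hρc : ContinuousAt ρ p := hρ.self_of_nhds.1.continuousAt
  have hρs : ∀ᶠ q in 𝓝 p, ρ q ∈ c.dom.source :=
    hρc.eventually_mem (by rw [hρp]; exact c.dom.open_source.mem_nhds hp)
  set w₀ := c.dom p with hw₀
  have hw₀t : w₀ ∈ c.dom.target := c.dom.map_source hp
  have hw₀1 : w₀.1 = c.cod y := by rw [← hfp, c.cod_apply p hp]
  have hsymm : Tendsto c.dom.symm (𝓝 w₀) (𝓝 p) := by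
    have := c.dom.continuousAt_symm hw₀t
    rwa [ContinuousAt, hw₀, c.dom.left_inv hp] at this
  -- This is `(ρ, f)` in coordinates: `ρ q` lies in the fibre, so its first coordinate is constant,
  -- and that slot holds the coordinate of `f q` instead.
  let R : EY × F → EY × F := fun w => (w.1, (c.dom (ρ (c.dom.symm w))).2)
  have hRdom : ∀ q ∈ c.dom.source, R (c.dom q) = (c.cod (f q), (c.dom (ρ q)).2) := by
    intro q hq
    simp only [R, c.dom.left_inv hq, c.cod_apply q hq]
  have hRw₀ : R w₀ = w₀ := by
    rw [hw₀, hRdom p hp, hρp, c.cod_apply p hp]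
  have hRs : ∀ᶠ w in 𝓝 w₀, ContDiffAt ℝ ∞ R w := by
    filter_upwards [hsymm.eventually hρ, hsymm.eventually hρs, c.dom.open_target.mem_nhds hw₀t]
      with w h1 h2 h3
    have h4 : ContMDiffAt 𝓘(ℝ, EY × F) 𝓘(ℝ, EY × F) ∞
        (fun w => c.dom (ρ (c.dom.symm w))) w :=
      (c.contMDiffAt_dom _ h2).comp w (h1.1.comp w (c.contMDiffAt_dom_symm w h3))
    exact contDiffAt_fst.prodMk h4.contDiffAt.snd
  obtain ⟨A, hA⟩ := exists_continuousLinearEquiv_hasFDerivAt (R := R) (a := w₀)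
    (hRs.self_of_nhds.differentiableAt (by simp)) (Eventually.of_forall fun w => rfl) (by
      have hc : Tendsto (fun v => ((w₀.1, v) : EY × F)) (𝓝 w₀.2) (𝓝 w₀) :=
        (Continuous.prodMk_right w₀.1).tendsto w₀.2
      filter_upwards [hc.eventually (hsymm.eventually hρ), hc (c.dom.open_target.mem_nhds hw₀t)]
        with v h1 h2
      have h3 := h1.2.2 (c.map_symm_eq h2 hy hw₀1)
      simp only [R, h3, c.dom.right_inv h2])
  obtain ⟨e, he₀, heR, hes⟩ := ContDiffAt.exists_openPartialHomeomorph hRs A hA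
  rw [hRw₀] at hes
  have hsymm₀ : e.symm w₀ = w₀ := by
    conv_lhs => rw [← hRw₀, ← heR, e.left_inv he₀]
  have hw₀e : w₀ ∈ e.target := by
    rw [← hRw₀, ← heR]; exact e.map_source he₀
  have hetend : Tendsto e.symm (𝓝 w₀) (𝓝 w₀) := by
    have := e.continuousAt_symm hw₀e
    rwa [ContinuousAt, hsymm₀] at this
  -- The coordinates that `R` should take at the preimage of `z`; the local inverse is then `u`,
  -- followed by the inverses of `R` and of the chart.
  let u : X × Y → EY × F := fun z => (c.cod z.2, (c.dom z.1).2)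
  have hup : u (p, y) = w₀ := Prod.ext hw₀1.symm rfl
  have hus : ∀ᶠ z in 𝓝 ((p, y) : X × Y),
      ContMDiffAt (𝓘(ℝ, EX).prod 𝓘(ℝ, EY)) 𝓘(ℝ, EY × F) ∞ u z := by
    filter_upwards [prod_mem_nhds (c.dom.open_source.mem_nhds hp) (c.cod.open_source.mem_nhds hy)]
      with z hz
    have h1 : ContMDiffAt (𝓘(ℝ, EX).prod 𝓘(ℝ, EY)) 𝓘(ℝ, EY) ∞ (fun z : X × Y => c.cod z.2) z :=
      (c.contMDiffAt_cod z.2 hz.2).comp z contMDiffAt_snd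
    have h2 : ContMDiffAt (𝓘(ℝ, EX).prod 𝓘(ℝ, EY)) 𝓘(ℝ, EY × F) ∞
        (fun z : X × Y => c.dom z.1) z :=
      (c.contMDiffAt_dom z.1 hz.1).comp z contMDiffAt_fst
    have h3 : ContMDiffAt (𝓘(ℝ, EX).prod 𝓘(ℝ, EY)) 𝓘(ℝ, F) ∞
        (fun z : X × Y => (c.dom z.1).2) z :=
      (contDiff_snd.contMDiff (n := ∞) (f := fun w : EY × F => w.2)).contMDiffAt.comp z h2
    exact h1.prodMk_space h3
  have hut : Tendsto u (𝓝 (p, y)) (𝓝 w₀) := by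
    have := hus.self_of_nhds.continuousAt
    rwa [ContinuousAt, hup] at this
  refine ⟨fun z => c.dom.symm (e.symm (u z)), ?_, ?_⟩
  · have h1 : ∀ᶠ q in 𝓝 p, c.dom q ∈ e.source :=
      (c.dom.continuousAt hp).eventually_mem (e.open_source.mem_nhds he₀)
    filter_upwards [h1, c.dom.open_source.mem_nhds hp] with q h1 h2
    have h3 : u (ρ q, f q) = e (c.dom q) := by rw [heR, hRdom q h2]
    simp only [h3, e.left_inv h1, c.dom.left_inv h2]
  · have h1 : Tendsto (fun z => e.symm (u z)) (𝓝 (p, y)) (𝓝 w₀) := hetend.comp hut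
    filter_upwards [hus, hut.eventually hes, h1 (c.dom.open_target.mem_nhds hw₀t),
      hut (e.open_target.mem_nhds hw₀e), h1.eventually (hsymm.eventually hρ),
      h1.eventually (hsymm.eventually hρs),
      prod_mem_nhds (c.dom.open_source.mem_nhds hp) (c.cod.open_source.mem_nhds hy)]
      with z hz1 hz2 hz3 hz4 hz5 hz6 hz7
    refine ⟨(c.contMDiffAt_dom_symm _ hz3).comp z (hz2.contMDiffAt.comp z hz1), fun hz => ?_⟩
    have hR : R (e.symm (u z)) = u z := by rw [← heR, e.right_inv hz4]
    have hR2 : (c.dom (ρ (c.dom.symm (e.symm (u z))))).2 = (c.dom z.1).2 := by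
      have := congrArg Prod.snd hR
      exact this
    have hfz : f (c.dom.symm (e.symm (u z))) = z.2 :=
      c.map_symm_eq hz3 hz7.2 (congrArg Prod.fst hR)
    refine ⟨hfz, c.dom.injOn hz6 hz7.1 (Prod.ext ?_ hR2)⟩
    rw [← c.cod_apply _ hz6, ← c.cod_apply _ hz7.1, hz5.2.1, hz]

end Ehresmann

/-! ### Consequences of properness at a point. -/

section ProperAt

variable {X Y : Type*} [TopologicalSpace X] [TopologicalSpace Y] {f : X → Y} {y : Y}

theorem ProperAt.isCompact_fiber [TopologicalSpace.PseudoMetrizableSpace X] [T1Space Y]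
    (h : ProperAt f y) (hf : Continuous f) : IsCompact (f ⁻¹' {y}) := by
  refine IsSeqCompact.isCompact fun a ha => ?_
  obtain ⟨p, φ, hφ, hp⟩ := h a (by
    rw [show (fun n => f (a n)) = fun _ => y from funext ha]; exact tendsto_const_nhds)
  exact ⟨p, (isClosed_singleton.preimage hf).mem_of_tendsto hp (Eventually.of_forall fun n =>
    ha (φ n)), φ, hφ, hp⟩

/-- Tube lemma: a neighbourhood of the fibre `f⁻¹(y)` contains the preimage of a neighbourhood of
`y`. -/
theorem ProperAt.eventually_of_nhdsSet [FirstCountableTopology Y] [T2Space Y] (h : ProperAt f y)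
    (hf : Continuous f) {P : X → Prop} (hP : ∀ᶠ q in 𝓝ˢ (f ⁻¹' {y}), P q) :
    ∀ᶠ v in 𝓝 y, ∀ q, f q = v → P q := by
  by_contra hcon
  obtain ⟨v, hv, hvP⟩ := exists_seq_forall_of_frequently (not_eventually.1 hcon)
  simp only [not_forall] at hvP
  choose a ha hna using hvP
  obtain ⟨p, φ, hφ, hp⟩ := h a (by simpa only [ha] using hv)
  have hfp : f p = y := by
    refine tendsto_nhds_unique ((hf.tendsto p).comp hp) ?_
    have := hv.comp hφ.tendsto_atTop
    simpa only [Function.comp_def, ha] using this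
  obtain ⟨n, hn⟩ := (hp.eventually (eventually_nhdsSet_iff_forall.1 hP p hfp)).exists
  exact hna _ hn

/-- If `f` is proper at `y` and `ρ` is locally injective on the fibres of `f` near `f⁻¹(y)`, and is
injective on `f⁻¹(y)`, then it is injective on all fibres of `f` near `y`. -/
theorem ProperAt.eventually_injOn [FirstCountableTopology Y] [T2Space Y] [T2Space X]
    (h : ProperAt f y) (hf : Continuous f) {Z : Type*} [TopologicalSpace Z] [T2Space Z] {ρ : X → Z}
    (hρc : ∀ p, f p = y → ContinuousAt ρ p) (hρi : InjOn ρ (f ⁻¹' {y}))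
    (hρ : ∀ p, f p = y → ∃ U ∈ 𝓝 p, ∀ q ∈ U, ∀ q' ∈ U, f q = f q' → ρ q = ρ q' → q = q') :
    ∀ᶠ v in 𝓝 y, ∀ q q', f q = v → f q' = v → ρ q = ρ q' → q = q' := by
  by_contra hcon
  obtain ⟨v, hv, hvP⟩ := exists_seq_forall_of_frequently (not_eventually.1 hcon)
  simp only [not_forall] at hvP
  choose a b ha hb hab hne using hvP
  obtain ⟨p, φ, hφ, hp⟩ := h a (by simpa only [ha] using hv)
  have hv' := hv.comp hφ.tendsto_atTop
  -- The second extraction is made along the first subsequence, so that both sequences converge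
  -- along the same indices.
  obtain ⟨p', φ', hφ', hp'⟩ := h (fun n => b (φ n)) (by
    simpa only [Function.comp_def, hb] using hv')
  replace hp := hp.comp hφ'.tendsto_atTop
  replace hv' := hv'.comp hφ'.tendsto_atTop
  have hfp : f p = y := by
    refine tendsto_nhds_unique ((hf.tendsto p).comp hp) ?_
    simpa only [Function.comp_def, ha] using hv'
  have hfp' : f p' = y := by
    refine tendsto_nhds_unique ((hf.tendsto p').comp hp') ?_
    simpa only [Function.comp_def, hb] using hv'
  have hpp : p = p' := by
    refine hρi hfp hfp' (tendsto_nhds_unique ((hρc p hfp).tendsto.comp hp) ?_)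
    have := (hρc p' hfp').tendsto.comp hp'
    simpa only [Function.comp_def, hab] using this
  subst hpp
  obtain ⟨U, hU, hUi⟩ := hρ p hfp
  obtain ⟨n, hn, hn'⟩ := ((hp.eventually_mem hU).and (hp'.eventually_mem hU)).exists
  exact hne _ (hUi _ hn _ hn' ((ha _).trans (hb _).symm) (hab _))

end ProperAt

/-! ### Ehresmann's theorem at a point. -/

section Ehresmann

variable {EX EY X Y : Type*}
    [NormedAddCommGroup EX] [NormedSpace ℝ EX] [NormedAddCommGroup EY] [NormedSpace ℝ EY]
    [TopologicalSpace X] [ChartedSpace EX X] [TopologicalSpace Y] [ChartedSpace EY Y]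
    {f : X → Y} {y : Y}

/-- Ehresmann's theorem: a submersion that is proper at `y` is locally trivial at `y`. -/
theorem ProperAt.locallyTrivialAt [FiniteDimensional ℝ EX] [FiniteDimensional ℝ EY]
    [T2Space X] [SecondCountableTopology X] [IsManifold 𝓘(ℝ, EX) ∞ X]
    [T2Space Y] [FirstCountableTopology Y] (h : ProperAt f y)
    (hf : Manifold.IsSubmersion 𝓘(ℝ, EX) 𝓘(ℝ, EY) ∞ f) : LocallyTrivialAt EX EY f y := by
  have : LocallyCompactSpace X := ChartedSpace.locallyCompactSpace EX X
  have hfc : Continuous f := hf.contMDiff.continuous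
  have hF : IsCompact (f ⁻¹' {y}) := h.isCompact_fiber hfc
  obtain ⟨ρ, hρ⟩ := hf.exists_retraction hF
  have hρF : ∀ p, f p = y → ∀ᶠ q in 𝓝 p, RetractsAt EX f y ρ q := eventually_nhdsSet_iff_forall.1 hρ
  have hloc : ∀ p, f p = y → ∃ Θ : X × Y → X, (∀ᶠ q in 𝓝 p, Θ (ρ q, f q) = q) ∧
      ∀ᶠ z in 𝓝 (p, y), ContMDiffAt (𝓘(ℝ, EX).prod 𝓘(ℝ, EY)) 𝓘(ℝ, EX) ∞ Θ z ∧
        (f z.1 = y → f (Θ z) = z.2 ∧ ρ (Θ z) = z.1) := by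
    intro p hp
    obtain ⟨F, _, _, _, c, hc⟩ := hf.exists_submersionChart p
    exact c.exists_local_inverse hc hp (hρF p hp)
  have h1 : ∀ᶠ v in 𝓝 y, ∀ q, f q = v → RetractsAt EX f y ρ q := h.eventually_of_nhdsSet hfc hρ
  have h2 : ∀ᶠ v in 𝓝 y, ∀ q q', f q = v → f q' = v → ρ q = ρ q' → q = q' := by
    refine h.eventually_injOn hfc (fun p hp => (hρF p hp).self_of_nhds.1.continuousAt) ?_ ?_
    · intro p hp q hq hpq
      rwa [(hρF p hp).self_of_nhds.2.2 hp, (hρF q hq).self_of_nhds.2.2 hq] at hpq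
    · intro p hp
      obtain ⟨Θ, hΘ, -⟩ := hloc p hp
      refine ⟨_, hΘ, fun q hq q' hq' h3 h4 => ?_⟩
      have hq : Θ (ρ q, f q) = q := hq
      have hq' : Θ (ρ q', f q') = q' := hq'
      rw [← hq, ← hq', h3, h4]
  -- Surjectivity: compactness of the fibre gives one neighbourhood of `y` that works for all its
  -- points.
  have h3 : ∀ᶠ v in 𝓝 y, ∀ p ∈ f ⁻¹' {y}, ∃ Θ : X × Y → X,
      ContMDiffAt (𝓘(ℝ, EX).prod 𝓘(ℝ, EY)) 𝓘(ℝ, EX) ∞ Θ (p, v) ∧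
      ∀ᶠ z in 𝓝 (p, v), f z.1 = y → f (Θ z) = z.2 ∧ ρ (Θ z) = z.1 := by
    refine hF.eventually_forall_of_forall_eventually fun p hp => ?_
    obtain ⟨Θ, -, hΘ⟩ := hloc p hp
    have hswap : Tendsto Prod.swap (𝓝 (y, p)) (𝓝 (p, y)) := continuous_swap.tendsto (y, p)
    filter_upwards [hswap.eventually hΘ.eventually_nhds] with z hz
    exact ⟨Θ, hz.self_of_nhds.1, hz.mono fun _ h => h.2⟩
  obtain ⟨V, hV, hVo, hyV⟩ := eventually_nhds_iff.1 (h1.and (h2.and h3))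
  refine ⟨V, hVo, hyV, fun q => (ρ q, f q), ?_⟩
  have hex : ∀ z : X × Y, ∃ q, z ∈ (f ⁻¹' {y}) ×ˢ V → f q = z.2 ∧ ρ q = z.1 := by
    intro z
    by_cases hz : z ∈ (f ⁻¹' {y}) ×ˢ V
    · obtain ⟨Θ, -, hΘ⟩ := (hV z.2 hz.2).2.2 z.1 hz.1
      exact ⟨Θ z, fun _ => hΘ.self_of_nhds hz.1⟩
    · exact ⟨z.1, fun h => absurd h hz⟩
  choose Φ hΦ using hex
  refine ⟨Φ, ?_, ?_, ?_, ?_, ⟨?_, ?_⟩, fun _ _ => rfl⟩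
  · intro q hq
    exact (((hV _ hq).1 q rfl).1.prodMk hf.contMDiff.contMDiffAt).contMDiffWithinAt
  · intro z hz
    obtain ⟨Θ, hΘs, hΘ⟩ := (hV z.2 hz.2).2.2 z.1 hz.1
    -- `Φ` is chosen point by point; injectivity of `ρ` on the fibres over `V` forces it to agree
    -- with the smooth `Θ`.
    have heq : ∀ z' ∈ (f ⁻¹' {y}) ×ˢ V, (f z'.1 = y → f (Θ z') = z'.2 ∧ ρ (Θ z') = z'.1) →
        Φ z' = Θ z' := fun z' hz' h' => (hV z'.2 hz'.2).2.1 _ _ (hΦ z' hz').1 (h' hz'.1).1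
          ((hΦ z' hz').2.trans (h' hz'.1).2.symm)
    refine ContMDiffWithinAt.congr_of_eventuallyEq hΘs.contMDiffWithinAt ?_
      (heq z hz hΘ.self_of_nhds)
    filter_upwards [self_mem_nhdsWithin, mem_nhdsWithin_of_mem_nhds hΘ] with z' h1 h2
    exact heq z' h1 h2
  · exact fun q hq => ⟨((hV _ hq).1 q rfl).2.1, hq⟩
  · intro z hz
    rw [mem_preimage, (hΦ z hz).1]
    exact hz.2
  · intro q hq
    have := hΦ (ρ q, f q) ⟨((hV _ hq).1 q rfl).2.1, hq⟩
    exact (hV _ hq).2.1 _ _ this.1 rfl this.2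
  · exact fun z hz => Prod.ext (hΦ z hz).2 (hΦ z hz).1

end Ehresmann

/-! ### Groupoid algebra and the topology of orbits and `s`-fibres. -/

namespace LieGroupoid

variable {EG EM G M : Type*}
  [NormedAddCommGroup EG] [NormedSpace ℝ EG] [NormedAddCommGroup EM] [NormedSpace ℝ EM]
  [TopologicalSpace G] [ChartedSpace EG G] [TopologicalSpace M] [ChartedSpace EM M]
  (𝒢 : LieGroupoid EG EM G M) {x : M}

theorem continuous_src : Continuous 𝒢.src := 𝒢.src_submersion.contMDiff.continuous

theorem continuous_tgt : Continuous 𝒢.tgt := 𝒢.tgt_submersion.contMDiff.continuous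

theorem tendsto_mul {ι : Type*} {l : Filter ι} {a b : ι → G} {g h : G} (ha : Tendsto a l (𝓝 g))
    (hb : Tendsto b l (𝓝 h)) (hgh : 𝒢.src g = 𝒢.tgt h)
    (hab : ∀ᶠ i in l, 𝒢.src (a i) = 𝒢.tgt (b i)) :
    Tendsto (fun i => 𝒢.mul (a i) (b i)) l (𝓝 (𝒢.mul g h)) :=
  (𝒢.mul_smooth.continuousOn (g, h) hgh).tendsto.comp
    (tendsto_nhdsWithin_iff.2 ⟨ha.prodMk_nhds hb, hab⟩)

theorem self_mem_orbit (x : M) : x ∈ 𝒢.orbit x := ⟨𝒢.unit x, 𝒢.src_unit x, 𝒢.tgt_unit x⟩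

theorem tgt_mem_orbit {g : G} (h : 𝒢.src g ∈ 𝒢.orbit x) : 𝒢.tgt g ∈ 𝒢.orbit x := by
  obtain ⟨k, hk, hkg⟩ := h
  exact ⟨𝒢.mul g k, (𝒢.src_mul _ _ hkg.symm).trans hk, 𝒢.tgt_mul _ _ hkg.symm⟩

theorem src_mem_orbit {g : G} (h : 𝒢.tgt g ∈ 𝒢.orbit x) : 𝒢.src g ∈ 𝒢.orbit x := by
  rw [← 𝒢.tgt_inv]
  exact 𝒢.tgt_mem_orbit (by rwa [𝒢.src_inv])

theorem exists_arrow_of_mem_orbit {z w : M} (hz : z ∈ 𝒢.orbit x) (hw : w ∈ 𝒢.orbit x) :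
    ∃ g, 𝒢.src g = w ∧ 𝒢.tgt g = z := by
  obtain ⟨h, hx, rfl⟩ := hz
  obtain ⟨k, kx, rfl⟩ := hw
  have hhk : 𝒢.src h = 𝒢.tgt (𝒢.inv k) := by rw [𝒢.tgt_inv, kx]; exact hx
  exact ⟨𝒢.mul h (𝒢.inv k), by rw [𝒢.src_mul _ _ hhk, 𝒢.src_inv], 𝒢.tgt_mul _ _ hhk⟩

theorem inv_mul_cancel_left {g h : G} (hgh : 𝒢.tgt g = 𝒢.tgt h) :
    𝒢.mul g (𝒢.mul (𝒢.inv g) h) = h := by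
  rw [← 𝒢.mul_assoc _ _ _ (𝒢.tgt_inv g).symm ((𝒢.src_inv g).trans hgh), 𝒢.mul_inv, hgh,
    𝒢.unit_mul]

section Topology

/-- The canonical topology is finer than the subspace topology, so compactness passes to the latter.
-/
theorem isCompact_orbit (h : 𝒢.OrbitCompact x) : IsCompact (𝒢.orbit x) := by
  have hc : @Continuous _ _ (𝒢.orbitTopology x) _ (Subtype.val : 𝒢.orbit x → M) :=
    continuous_coinduced_dom.2 (𝒢.continuous_tgt.comp continuous_subtype_val)
  have := @isCompact_range _ _ (𝒢.orbitTopology x) _ h _ hc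
  rwa [Subtype.range_coe] at this

theorem orbitCompact_of_isCompact_sFiber (h : IsCompact (𝒢.sFiber x)) : 𝒢.OrbitCompact x := by
  have : CompactSpace (𝒢.sFiber x) := isCompact_iff_compactSpace.1 h
  have hsurj : Function.Surjective (𝒢.toOrbit x) := by
    rintro ⟨_, g, hg, rfl⟩
    exact ⟨⟨g, hg⟩, rfl⟩
  let := 𝒢.orbitTopology x
  exact hsurj.compactSpace continuous_coinduced_rng

theorem isCompact_isotropy_of_isCompact_sFiber [T1Space M] (h : IsCompact (𝒢.sFiber x)) :
    IsCompact (𝒢.isotropy x) :=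
  h.inter_right (isClosed_singleton.preimage 𝒢.continuous_tgt)

/-- The map from the `s`-fibre to the orbit is open. -/
theorem isOpenMap_toOrbit (x : M) :
    @IsOpenMap _ _ _ (𝒢.orbitTopology x) (𝒢.toOrbit x) := by
  intro U hU
  rw [isOpen_coinduced, isOpen_iff_mem_nhds]
  rintro ⟨g, hg⟩ ⟨⟨u, hu⟩, huU, hug⟩
  have htgt : 𝒢.tgt g = 𝒢.tgt u := (congrArg Subtype.val hug).symm
  obtain ⟨U', hU', rfl⟩ := isOpen_induced_iff.1 hU
  -- Right translation by the isotropy element `g⁻¹u` keeps targets and takes `g` to `u`, hence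
  -- arrows near `g` into `U'`.
  set h := 𝒢.mul (𝒢.inv g) u with hh
  have hth : 𝒢.tgt h = x := by
    rw [hh, 𝒢.tgt_mul _ _ ((𝒢.src_inv g).trans htgt), 𝒢.tgt_inv]; exact hg
  have hsh : 𝒢.src h = x := by
    rw [hh, 𝒢.src_mul _ _ ((𝒢.src_inv g).trans htgt)]; exact hu
  have hgh : 𝒢.mul g h = u := 𝒢.inv_mul_cancel_left htgt
  have hlim : Tendsto (fun k : 𝒢.sFiber x => 𝒢.mul k h) (𝓝 ⟨g, hg⟩) (𝓝 (𝒢.mul g h)) :=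
    𝒢.tendsto_mul continuous_subtype_val.continuousAt tendsto_const_nhds
      ((show 𝒢.src g = x from hg).trans hth.symm)
      (Eventually.of_forall fun k => (show 𝒢.src k = x from k.2).trans hth.symm)
  rw [hgh] at hlim
  filter_upwards [hlim.eventually_mem (hU'.mem_nhds huU)] with k hk
  have hkh : 𝒢.src k = 𝒢.tgt h := (show 𝒢.src k = x from k.2).trans hth.symm
  exact ⟨⟨𝒢.mul k h, (𝒢.src_mul _ _ hkh).trans hsh⟩, hk, Subtype.ext (𝒢.tgt_mul _ _ hkh)⟩

/-- The product of a compact part of the `s`-fibre with a compact isotropy group is compact. -/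
theorem isCompact_image2_isotropy {K : Set G} (hK : IsCompact K) (hKx : K ⊆ 𝒢.sFiber x)
    (h : IsCompact (𝒢.isotropy x)) : IsCompact (image2 𝒢.mul K (𝒢.isotropy x)) := by
  rw [← image_prod]
  exact (hK.prod h).image_of_continuousOn <| 𝒢.mul_smooth.continuousOn.mono fun p hp =>
    (show 𝒢.src p.1 = x from hKx hp.1).trans hp.2.2.symm

/-- If the isotropy group and the orbit are compact, then so is the `s`-fibre. -/
theorem isCompact_sFiber [LocallyCompactSpace G] [T1Space M] (hiso : IsCompact (𝒢.isotropy x))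
    (horb : 𝒢.OrbitCompact x) : IsCompact (𝒢.sFiber x) := by
  have hcl : IsClosed (𝒢.sFiber x) := isClosed_singleton.preimage 𝒢.continuous_src
  have hK : ∀ g : 𝒢.sFiber x, ∃ K : Set G, IsCompact K ∧ K ∈ 𝓝 (g : G) := fun g =>
    exists_compact_mem_nhds (g : G)
  choose K hKc hKn using hK
  let := 𝒢.orbitTopology x
  have : CompactSpace (𝒢.orbit x) := horb
  let W : 𝒢.sFiber x → Set (𝒢.orbit x) := fun g =>
    𝒢.toOrbit x '' (Subtype.val ⁻¹' interior (K g))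
  have hW : ∀ g, IsOpen (W g) := fun g =>
    𝒢.isOpenMap_toOrbit x _ (isOpen_interior.preimage continuous_subtype_val)
  have hcov : (univ : Set (𝒢.orbit x)) ⊆ ⋃ g, W g := by
    rintro ⟨_, g, hg, rfl⟩ -
    exact mem_iUnion.2 ⟨⟨g, hg⟩, ⟨g, hg⟩, mem_interior_iff_mem_nhds.2 (hKn ⟨g, hg⟩), rfl⟩
  obtain ⟨t, ht⟩ := isCompact_univ.elim_finite_subcover W hW hcov
  -- Finitely many compact pieces meet every target; an arrow `k` with the same target as `u` in a
  -- piece is `u · (u⁻¹k)`, with `u⁻¹k` in the isotropy group.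
  refine IsCompact.of_isClosed_subset (t.isCompact_biUnion fun g _ =>
    𝒢.isCompact_image2_isotropy ((hKc g).inter_right hcl) inter_subset_right hiso) hcl ?_
  intro k hk
  obtain ⟨g, hg, u, huK, huk⟩ := mem_iUnion₂.1 (ht (mem_univ (𝒢.toOrbit x ⟨k, hk⟩)))
  have htgt : 𝒢.tgt u = 𝒢.tgt k := congrArg Subtype.val huk
  have huk' : 𝒢.src (𝒢.inv u) = 𝒢.tgt k := (𝒢.src_inv _).trans htgt
  refine mem_iUnion₂.2 ⟨g, hg, u, ⟨interior_subset huK, u.2⟩, 𝒢.mul (𝒢.inv u) k, ⟨?_, ?_⟩,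
    𝒢.inv_mul_cancel_left htgt⟩
  · exact (𝒢.src_mul _ _ huk').trans hk
  · rw [𝒢.tgt_mul _ _ huk', 𝒢.tgt_inv]
    exact u.2

end Topology

/-! ### The implications between the three conditions. -/

theorem IsSProperAt.isProperAt {𝒢 : LieGroupoid EG EM G M} (h : 𝒢.IsSProperAt x) :
    𝒢.IsProperAt x :=
  fun a ha => h a ((continuous_snd.tendsto _).comp ha)

/-- By the tube lemma, arrows starting in some open `W ∋ x` end in `U`. The saturation `t(s⁻¹(W))`
is open because `t` is an open map. -/
theorem IsSProperAt.orbitStable [FiniteDimensional ℝ EG] [FirstCountableTopology M] [T2Space M]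
    {𝒢 : LieGroupoid EG EM G M} (h : 𝒢.IsSProperAt x) : 𝒢.OrbitStable x := by
  intro U hU hxU
  have h1 : ∀ᶠ q in 𝓝ˢ (𝒢.src ⁻¹' {x}), 𝒢.tgt q ∈ U :=
    (hU.preimage 𝒢.continuous_tgt).mem_nhdsSet.2 fun g hg => hxU ⟨g, hg, rfl⟩
  obtain ⟨W, hW, hWo, hxW⟩ := eventually_nhds_iff.1
    (ProperAt.eventually_of_nhdsSet h 𝒢.continuous_src h1)
  refine ⟨𝒢.tgt '' (𝒢.src ⁻¹' W),
    𝒢.tgt_submersion.isOpenMap _ (hWo.preimage 𝒢.continuous_src), ?_, ?_, ?_⟩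
  · rintro _ ⟨g, hg, rfl⟩ _ ⟨k, hk, rfl⟩
    have hk : 𝒢.src k = 𝒢.tgt g := hk
    exact ⟨𝒢.mul k g, by rwa [mem_preimage, 𝒢.src_mul _ _ hk], 𝒢.tgt_mul _ _ hk⟩
  · rintro _ ⟨g, hg, rfl⟩
    exact ⟨g, by rwa [mem_preimage, show 𝒢.src g = x from hg], rfl⟩
  · rintro _ ⟨g, hg, rfl⟩
    exact hW _ hg g rfl

/-- A map that is locally trivial at `y` with compact fibre is proper at `y`. -/
theorem _root_.LocallyTrivialAt.properAt {EX EY X Y : Type*}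
    [NormedAddCommGroup EX] [NormedSpace ℝ EX] [NormedAddCommGroup EY] [NormedSpace ℝ EY]
    [TopologicalSpace X] [ChartedSpace EX X] [TopologicalSpace Y] [ChartedSpace EY Y]
    [FirstCountableTopology X] {f : X → Y} {y : Y} (h : LocallyTrivialAt EX EY f y)
    (hc : IsCompact (f ⁻¹' {y})) : ProperAt f y := by
  obtain ⟨V, hV, hyV, Ψ, Φ, -, hΦ, hΨm, -, hinv, hΨ⟩ := h
  intro a ha
  obtain ⟨N, hN⟩ := eventually_atTop.1 (ha.eventually_mem (hV.mem_nhds hyV))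
  have hmem : ∀ n, a (n + N) ∈ f ⁻¹' V := fun n => hN _ (Nat.le_add_left N n)
  obtain ⟨p, hp, φ, hφ, hlim⟩ := hc.tendsto_subseq fun n => (hΨm (hmem n)).1
  have hφN : StrictMono fun n => φ n + N := hφ.add_const N
  refine ⟨Φ (p, y), fun n => φ n + N, hφN, ?_⟩
  have h1 : Tendsto (fun n => Ψ (a (φ n + N))) atTop (𝓝[(f ⁻¹' {y}) ×ˢ V] (p, y)) := by
    refine tendsto_nhdsWithin_iff.2 ⟨?_, Eventually.of_forall fun n => hΨm (hmem _)⟩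
    have h2 : Tendsto (fun n => (Ψ (a (φ n + N))).2) atTop (𝓝 y) :=
      (ha.comp hφN.tendsto_atTop).congr fun n => (hΨ _ (hmem _)).symm
    exact hlim.prodMk_nhds h2
  have h3 := ((hΦ.continuousOn (p, y) ⟨hp, hyV⟩).tendsto.comp h1)
  exact h3.congr fun n => hinv.1 (hmem _)

/-- Properness at `x` gives convergent subsequences of arrows with sources converging to `x` and
targets converging to a point of the orbit of `x`. -/
theorem IsProperAt.exists_tendsto_subseq [FiniteDimensional ℝ EG] [T2Space M]
    {𝒢 : LieGroupoid EG EM G M} (h : 𝒢.IsProperAt x) {a : ℕ → G} {z : M}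
    (hs : Tendsto (fun n => 𝒢.src (a n)) atTop (𝓝 x))
    (ht : Tendsto (fun n => 𝒢.tgt (a n)) atTop (𝓝 z)) (hz : z ∈ 𝒢.orbit x) :
    ∃ (p : G) (φ : ℕ → ℕ), StrictMono φ ∧ Tendsto (fun n => a (φ n)) atTop (𝓝 p) := by
  obtain ⟨k, hk, rfl⟩ := hz
  have hk : 𝒢.src k = x := hk
  obtain ⟨σ, hσk, hσc, hσ⟩ := 𝒢.tgt_submersion.exists_local_section k
  have hσa : Tendsto (fun n => σ (𝒢.tgt (a n))) atTop (𝓝 k) := by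
    have := hσc.tendsto.comp ht
    rwa [hσk] at this
  have hev : ∀ᶠ n in atTop, 𝒢.tgt (σ (𝒢.tgt (a n))) = 𝒢.tgt (a n) := ht.eventually hσ
  -- Composing with the inverse of an arrow near `k` that has the same target moves the targets to
  -- near `x` and keeps the sources.
  set b : ℕ → G := fun n => 𝒢.mul (𝒢.inv (σ (𝒢.tgt (a n)))) (a n) with hb
  have hbs : ∀ᶠ n in atTop, 𝒢.src (b n) = 𝒢.src (a n) := by
    filter_upwards [hev] with n hn
    exact 𝒢.src_mul _ _ ((𝒢.src_inv _).trans hn)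
  have hbt : ∀ᶠ n in atTop, 𝒢.tgt (b n) = 𝒢.src (σ (𝒢.tgt (a n))) := by
    filter_upwards [hev] with n hn
    rw [hb, 𝒢.tgt_mul _ _ ((𝒢.src_inv _).trans hn), 𝒢.tgt_inv]
  have hbt' : Tendsto (fun n => 𝒢.tgt (b n)) atTop (𝓝 x) := by
    have := (𝒢.continuous_src.tendsto k).comp hσa
    rw [hk] at this
    exact this.congr' (hbt.mono fun n hn => hn.symm)
  have hbs' : Tendsto (fun n => 𝒢.src (b n)) atTop (𝓝 x) :=
    hs.congr' (hbs.mono fun n hn => hn.symm)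
  obtain ⟨p, φ, hφ, hp⟩ := h b (hbt'.prodMk_nhds hbs')
  have htp : 𝒢.tgt p = x :=
    tendsto_nhds_unique ((𝒢.continuous_tgt.tendsto p).comp hp) (hbt'.comp hφ.tendsto_atTop)
  refine ⟨𝒢.mul k p, φ, hφ, ?_⟩
  refine (𝒢.tendsto_mul (hσa.comp hφ.tendsto_atTop) hp (hk.trans htp.symm) ?_).congr' ?_
  · exact (hφ.tendsto_atTop.eventually hbt).mono fun n hn => hn.symm
  · exact (hφ.tendsto_atTop.eventually hev).mono fun n hn => 𝒢.inv_mul_cancel_left hn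

/-- If the orbit of `x` is stable, then arrows with sources converging to `x` and targets outside
the orbit have targets that accumulate at the orbit. -/
theorem OrbitStable.exists_tendsto_tgt_subseq [T1Space M] [FirstCountableTopology M]
    {𝒢 : LieGroupoid EG EM G M} (h : 𝒢.OrbitStable x) {a : ℕ → G}
    (hs : Tendsto (fun n => 𝒢.src (a n)) atTop (𝓝 x)) (ha : ∀ n, 𝒢.tgt (a n) ∉ 𝒢.orbit x) :
    ∃ z ∈ 𝒢.orbit x, ∃ φ : ℕ → ℕ, StrictMono φ ∧
      Tendsto (fun n => 𝒢.tgt (a (φ n))) atTop (𝓝 z) := by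
  by_contra! hcon
  have hU : 𝒢.orbit x ⊆ interior (range fun n => 𝒢.tgt (a n))ᶜ := by
    intro z hz
    rw [mem_interior_iff_mem_nhds]
    have hncl : ¬ MapClusterPt z atTop fun n => 𝒢.tgt (a n) := fun hcl => by
      obtain ⟨φ, hφ, hlim⟩ := hcl.tendsto_subseq
      exact hcon z hz φ hφ hlim
    simp only [mapClusterPt_iff_frequently, not_forall, not_frequently] at hncl
    obtain ⟨N, hN, hev⟩ := hncl
    obtain ⟨n₀, hn₀⟩ := eventually_atTop.1 hev
    -- The finitely many early targets lie off the orbit, so they differ from `z` and can be avoided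
    -- too.
    have hfin : ∀ᶠ w in 𝓝 z, ∀ n ∈ Finset.range n₀, w ≠ 𝒢.tgt (a n) :=
      (Filter.eventually_all_finset _).2 fun n _ =>
        isOpen_ne.mem_nhds fun hzn => ha n (hzn ▸ hz)
    filter_upwards [hN, hfin] with w hw1 hw2
    rintro ⟨n, rfl⟩
    rcases lt_or_ge n n₀ with hn | hn
    · exact hw2 n (Finset.mem_range.2 hn) rfl
    · exact hn₀ n hn hw1
  obtain ⟨V, hVo, hVs, hxV, hVU⟩ := h _ isOpen_interior hU
  obtain ⟨n, hn⟩ := (hs.eventually_mem (hVo.mem_nhds (hxV (𝒢.self_mem_orbit x)))).exists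
  exact interior_subset (hVU (hVs _ hn ⟨a n, rfl, rfl⟩)) ⟨n, rfl⟩

/-- If an orbit is not open, then the arrows with targets outside the orbit are dense. -/
theorem dense_tgt_notMem_orbit [FiniteDimensional ℝ EG] (h : ¬ IsOpen (𝒢.orbit x)) :
    Dense {g | 𝒢.tgt g ∉ 𝒢.orbit x} := by
  rw [dense_iff_inter_open]
  intro U hU ⟨g, hg⟩
  by_contra hne
  have hUx : ∀ k ∈ U, 𝒢.tgt k ∈ 𝒢.orbit x := fun k hk => by
    by_contra hkx
    exact hne ⟨k, hk, hkx⟩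
  apply h
  -- If all arrows of the open set `U` end in the orbit, the orbit is the saturation of the open set
  -- `t(U)`, hence open.
  have heq : 𝒢.orbit x = 𝒢.tgt '' (𝒢.src ⁻¹' (𝒢.tgt '' U)) := by
    ext z
    constructor
    · intro hz
      obtain ⟨k, hk, hkz⟩ := 𝒢.exists_arrow_of_mem_orbit hz (hUx g hg)
      exact ⟨k, ⟨g, hg, hk.symm⟩, hkz⟩
    · rintro ⟨k, ⟨u, hu, huk⟩, rfl⟩
      exact 𝒢.tgt_mem_orbit (huk ▸ hUx u hu)
  rw [heq]
  exact 𝒢.tgt_submersion.isOpenMap _ ((𝒢.tgt_submersion.isOpenMap _ hU).preimage 𝒢.continuous_src)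

theorem IsProperAt.isSProperAt [FiniteDimensional ℝ EG] [TopologicalSpace.MetrizableSpace M]
    {𝒢 : LieGroupoid EG EM G M} (h : 𝒢.IsProperAt x) (hst : 𝒢.OrbitStable x)
    (hop : IsOpen (𝒢.orbit x) → 𝒢.OrbitCompact x) : 𝒢.IsSProperAt x := by
  intro a hs
  suffices ∃ z ∈ 𝒢.orbit x, ∃ φ : ℕ → ℕ, StrictMono φ ∧
      Tendsto (fun n => 𝒢.tgt (a (φ n))) atTop (𝓝 z) by
    obtain ⟨z, hz, φ, hφ, hlim⟩ := this
    obtain ⟨p, φ', hφ', hp⟩ := h.exists_tendsto_subseq (hs.comp hφ.tendsto_atTop) hlim hz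
    exact ⟨p, φ ∘ φ', hφ.comp hφ', hp⟩
  by_cases hO : IsOpen (𝒢.orbit x)
  · have hev : ∀ᶠ n in atTop, 𝒢.tgt (a n) ∈ 𝒢.orbit x :=
      (hs.eventually_mem (hO.mem_nhds (𝒢.self_mem_orbit x))).mono fun n hn => 𝒢.tgt_mem_orbit hn
    obtain ⟨z, hz, φ, hφ, hlim⟩ :=
      (𝒢.isCompact_orbit (hop hO)).tendsto_subseq' hev.frequently
    exact ⟨z, hz, φ, hφ, hlim⟩
  · let := TopologicalSpace.metrizableSpaceMetric M
    -- Shifts by less than `1/(n+1)` preserve the limit of the sources, and a limit of the shifted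
    -- targets is one of the original targets.
    have hex : ∀ n : ℕ, ∃ g, 𝒢.tgt g ∉ 𝒢.orbit x ∧
        dist (𝒢.src (a n)) (𝒢.src g) < 1 / ((n : ℝ) + 1) ∧
        dist (𝒢.tgt (a n)) (𝒢.tgt g) < 1 / ((n : ℝ) + 1) := by
      intro n
      have hpos : 0 < 1 / ((n : ℝ) + 1) := Nat.one_div_pos_of_nat
      have h1 : ∀ᶠ g in 𝓝 (a n), dist (𝒢.src (a n)) (𝒢.src g) < 1 / ((n : ℝ) + 1) :=
        ((continuous_const.dist 𝒢.continuous_src).tendsto (a n)).eventually_lt_const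
          (by rwa [dist_self])
      have h2 : ∀ᶠ g in 𝓝 (a n), dist (𝒢.tgt (a n)) (𝒢.tgt g) < 1 / ((n : ℝ) + 1) :=
        ((continuous_const.dist 𝒢.continuous_tgt).tendsto (a n)).eventually_lt_const
          (by rwa [dist_self])
      obtain ⟨g, hgO, hg⟩ := (𝒢.dense_tgt_notMem_orbit hO).inter_nhds_nonempty (h1.and h2)
      exact ⟨g, hgO, hg⟩
    choose b hbO hbs hbt using hex
    have hzero : ∀ {u : ℕ → ℝ}, (∀ n, 0 ≤ u n) → (∀ n, u n < 1 / ((n : ℝ) + 1)) →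
        Tendsto u atTop (𝓝 0) := fun h1 h2 =>
      squeeze_zero h1 (fun n => (h2 n).le) tendsto_one_div_add_atTop_nhds_zero_nat
    have hs' : Tendsto (fun n => 𝒢.src (b n)) atTop (𝓝 x) :=
      (tendsto_iff_of_dist (hzero (fun _ => dist_nonneg) hbs)).1 hs
    obtain ⟨z, hz, φ, hφ, hlim⟩ := hst.exists_tendsto_tgt_subseq hs' hbO
    exact ⟨z, hz, φ, hφ, (tendsto_iff_of_dist
      ((hzero (fun _ => dist_nonneg) hbt).comp hφ.tendsto_atTop)).2 hlim⟩

end LieGroupoid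

theorem mainTheorem8 {EG EM G M : Type*}
    [NormedAddCommGroup EG] [NormedSpace ℝ EG] [FiniteDimensional ℝ EG]
    [NormedAddCommGroup EM] [NormedSpace ℝ EM] [FiniteDimensional ℝ EM]
    [TopologicalSpace G] [T2Space G] [SecondCountableTopology G]
    [ChartedSpace EG G] [IsManifold 𝓘(ℝ, EG) ∞ G]
    [TopologicalSpace M] [T2Space M] [SecondCountableTopology M]
    [ChartedSpace EM M] [IsManifold 𝓘(ℝ, EM) ∞ M]
    (𝒢 : LieGroupoid EG EM G M) (x : M) :
    List.TFAE [
      𝒢.IsSProperAt x,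
      𝒢.IsProperAt x ∧ 𝒢.OrbitStable x ∧ (IsOpen (𝒢.orbit x) → 𝒢.OrbitCompact x),
      𝒢.IsSLocallyTrivialAt x ∧ IsCompact (𝒢.isotropy x) ∧ 𝒢.OrbitCompact x] := by
  -- With Hausdorffness and second countability this makes `G` and `M` metrizable, as the sequence
  -- and distance arguments require.
  have : LocallyCompactSpace G := ChartedSpace.locallyCompactSpace EG G
  have : LocallyCompactSpace M := ChartedSpace.locallyCompactSpace EM M
  have hfib (h : 𝒢.IsSProperAt x) : IsCompact (𝒢.sFiber x) :=
    ProperAt.isCompact_fiber h 𝒢.continuous_src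
  tfae_have 1 → 2 := fun h =>
    ⟨h.isProperAt, h.orbitStable, fun _ => 𝒢.orbitCompact_of_isCompact_sFiber (hfib h)⟩
  tfae_have 2 → 1 := fun ⟨h, hst, hop⟩ => h.isSProperAt hst hop
  tfae_have 1 → 3 := fun h =>
    ⟨ProperAt.locallyTrivialAt h 𝒢.src_submersion,
      𝒢.isCompact_isotropy_of_isCompact_sFiber (hfib h),
      𝒢.orbitCompact_of_isCompact_sFiber (hfib h)⟩
  tfae_have 3 → 1 := fun ⟨hlt, hiso, horb⟩ =>
    LocallyTrivialAt.properAt hlt (𝒢.isCompact_sFiber hiso horb)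
  tfae_finish
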